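/- For a finite set $I$, a configuration $\omega\in\{0,1\}^I$ and $S\subseteq I$, let $[\omega]_S=\{\alpha\in\{0,1\}^I : \alpha_i=\omega_i \text{ for all } i\in S\}$. For $A,B\subseteq\{0,1\}^I$ let $$A\,\square\,B=\{\omega\in\{0,1\}^I : \text{there are disjoint } K,L\subseteq I \text{ with } [\omega]_K\subseteq A \text{ and } [\omega]_L\subseteq B\}.$$ A set $A\subseteq\{0,1\}^I$ is increasing if $\omega\in A$ and $\omega'_i\ge\omega_i$ for all $i\in I$ imply $\omega'\in A$. A probability measure $P$ on $\{0,1\}^I$ has the BK property if $P(A\,\square\,B)\le P(A)P(B)$ for all increasing $A,B\subseteq\{0,1\}^I$. For integers $0\le k\le n$ and non-negative real numbers $w=(w_1,\dots,w_n)$, at least $k$ of which are positive, let $P^w_{k,n}$ be the weighted $k$-out-of-$n$ (conditional Poisson) measure, that is, the probability measure on $\{0,1\}^n$ with $$P^w_{k,n}(\omega)=C\; I(|\omega|=k)\,\prod_{i=1}^n w_i^{\omega_i},\qquad |\omega|=\sum_{i=1}^n\omega_i,$$ where $C$ is the normalizing constant and $0^0=1$. Theorem. (1) Every measure $P^w_{k,n}$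 has the BK property. (2) Every finite product $P^{w^{(1)}}_{k_1,n_1}\times\cdots\times P^{w^{(l)}}_{k_l,n_l}$ of such measures, regarded as a probability measure on $\{0,1\}^{n_1+\cdots+n_l}$, has the BK property. -/

import Mathlib

open MeasureTheory
open scoped NNReal ENNReal

namespace BKProperty

/-- The cylinder `[ω]_S`: all configurations in `{0,1}^ι` that agree with `ω` on `S`. -/
def cylinder {ι : Type*} (ω : ι → Bool) (S : Set ι) : Set (ι → Bool) :=
  {α | ∀ i ∈ S, α i = ω i}

/-- The event `A □ B` that `A` and `B` occur disjointly. -/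
def box {ι : Type*} (A B : Set (ι → Bool)) : Set (ι → Bool) :=
  {ω | ∃ K L : Set ι, Disjoint K L ∧ cylinder ω K ⊆ A ∧ cylinder ω L ⊆ B}

/-- The BK property: the BK inequality holds for all increasing events. The order on `ι → Bool`
is the coordinatewise one (with `false < true`), so increasing events are the upper sets. -/
def IsBK {ι : Type*} (μ : Measure (ι → Bool)) : Prop :=
  ∀ A B : Set (ι → Bool), IsUpperSet A → IsUpperSet B → μ (box A B) ≤ μ A * μ B

/-- The number `|ω|` of ones of the configuration `ω`. -/
def numOnes {ι : Type*} [Fintype ι] (ω : ι → Bool) : ℕ :=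
  ∑ i, (ω i).toNat

/-- The unnormalized weight `I(|ω| = k) ∏ i, w i ^ ω i`. -/
def rawWeight {ι : Type*} [Fintype ι] (k : ℕ) (w : ι → ℝ≥0) (ω : ι → Bool) : ℝ≥0 :=
  if numOnes ω = k then ∏ i, w i ^ (ω i).toNat else 0

/-- The sum of all unnormalized weights, whose inverse is the normalizing constant. -/
def totalWeight {ι : Type*} [Fintype ι] [DecidableEq ι] (k : ℕ) (w : ι → ℝ≥0) : ℝ≥0 :=
  ∑ ω : ι → Bool, rawWeight k w ω

/-- The weighted `k`-out-of-`n` (conditional Poisson) measure on `{0,1}^ι`; it is a probability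
measure exactly if `totalWeight k w ≠ 0`. -/
noncomputable def weightedMeasure {ι : Type*} [Fintype ι] [DecidableEq ι]
    (k : ℕ) (w : ι → ℝ≥0) : Measure (ι → Bool) :=
  ∑ ω : ι → Bool, ((rawWeight k w ω / totalWeight k w : ℝ≥0) : ℝ≥0∞) • Measure.dirac ω

/-- The product of measures `μ j` on `{0,1}^(κ j)`, as a measure on `{0,1}^(Σ j, κ j)`: the
index set is the disjoint union of the index sets of the factors. -/
noncomputable def productMeasure {J : Type*} [Fintype J] {κ : J → Type*}
    (μ : (j : J) → Measure (κ j → Bool)) : Measure ((Σ j, κ j) → Bool) :=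
  (Measure.pi μ).map (fun (x : (j : J) → κ j → Bool) (p : Σ j, κ j) => x p.1 p.2)

end BKProperty

/-! Colour the coordinates by the factor they belong to; one factor means one colour. With `W` the
unnormalized weight, BK compares the `W ω * W ω'`-mass of pairs with `ω ∈ box A B` to that of pairs
with `ω ∈ A` and `ω' ∈ B`.

Two configurations of positive weight have equally many ones of each colour. Hence `ω' = ω ∘ τ` for
some colour-preserving involution `τ` whose 2-cycles each join a one of `ω` to a zero. The mass of a
pair is shared equally among all such `τ` (`sum_sum_eq_sum_mates`).

Fix `τ` and the values at its fixed points. The remaining configurations form a cube with one bit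
per 2-cycle, on which `ω ↦ ω ∘ τ` is the antipodal map and the shared mass is constant. Since `A`
and `B` are increasing, disjoint occurrence passes to this cube. Reimer's inequality `ncard_box_le`
there compares the counts, and summing over fibers and over `τ` gives BK. -/

namespace BKProperty

/-- The four plane vectors attached to a coordinate: orthogonal pairs `(1,0)`, `(0,1)` for the
value `false` and `(1,1)`, `(-1,1)` for the value `true`. -/
def planeVec : Bool → Bool → Bool → ℤ
  | true, false, false => 1
  | true, false, true => 0
  | false, false, false => 0
  | false, false, true => 1
  | true, true, _ => 1
  | false, true, false => -1
  | false, true, true => 1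

/-- Coordinates of `planeVec` in the basis `(1,0)`, `(1,1)`. -/
def planeCoord : Bool → Bool → Bool → ℤ
  | true, c, z => if z = c then 1 else 0
  | false, false, false => -1
  | false, true, false => -2
  | false, _, true => 1

/-- Inner products of `planeVec` with `(1,0)` and `(1,1)`. -/
def planeDual : Bool → Bool → Bool → ℤ
  | true, false, _ => 1
  | true, true, false => 1
  | true, true, true => 2
  | false, false, z => if z then 1 else 0
  | false, true, z => if z then 0 else -1

/-- Expanding the first vector in the basis `(1,0)`, `(1,1)` turns its inner product with the second
into coefficients times inner products with the basis. -/
theorem planeCoord_mul_planeDual (k c k' c' : Bool) :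
    ∑ z, planeCoord k c z * planeDual k' c' z = ∑ z, planeVec k c z * planeVec k' c' z := by
  revert k c k' c'; decide

theorem eq_of_planeCoord_ne_zero {c z : Bool} (h : planeCoord true c z ≠ 0) : z = c := by
  revert c z; decide

/-- The vector of class `false` and value `c` is orthogonal to the basis vector labelled `c`. This
is where antipodes enter Reimer's inequality. -/
theorem eq_of_planeDual_ne_zero {c z : Bool} (h : planeDual false c z ≠ 0) : z = !c := by
  revert c z; decide

/-! ### Reimer's inequality by linear algebra -/

section Reimer

variable {ι : Type*} [Fintype ι] [DecidableEq ι]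

theorem sum_prod_mul_prod {R : Type*} [CommRing R] (f g : ι → Bool → R) :
    ∑ z : ι → Bool, (∏ i, f i (z i)) * ∏ i, g i (z i) = ∏ i, ∑ b, f i b * g i b := by
  rw [Finset.prod_univ_sum, Fintype.piFinset_univ]
  simp only [Finset.prod_mul_distrib]

/-- The tensor products of the plane vectors selected by `κ`, as rows of a matrix. -/
def tensorMatrix (κ : (ι → Bool) → ι → Bool) : Matrix (ι → Bool) (ι → Bool) ℤ :=
  Matrix.of fun x z => ∏ i, planeVec (κ x i) (x i) (z i)

/-- The change of basis that makes the reduction of `tensorMatrix` modulo `2` triangular. -/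
def sieveMatrix : Matrix (ι → Bool) (ι → Bool) (ZMod 2) :=
  Matrix.of fun z y => ∏ i, if y i && z i then 0 else 1

theorem tensorMatrix_mul_sieveMatrix_apply (κ : (ι → Bool) → ι → Bool) (x y : ι → Bool) :
    ((tensorMatrix κ).map (Int.cast : ℤ → ZMod 2) * (sieveMatrix : Matrix (ι → Bool) (ι → Bool) (ZMod 2)) :
      Matrix (ι → Bool) (ι → Bool) (ZMod 2)) x y =
      ∏ i, ∑ b, (planeVec (κ x i) (x i) b : ZMod 2) * (if y i && b then 0 else 1) := by
  rw [Matrix.mul_apply, ← sum_prod_mul_prod]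
  simp [tensorMatrix, sieveMatrix]

/-- Modulo 2 the vectors `(1,1)` and `(-1,1)` coincide. After the change of basis every factor has
diagonal value 1 and vanishes unless `c ≤ y`, whatever the classes chosen by `κ`. -/
theorem det_tensorMatrix_ne_zero (κ : (ι → Bool) → ι → Bool) : (tensorMatrix κ).det ≠ 0 := by
  have hle : ∀ k c y : Bool, ∑ b, (planeVec k c b : ZMod 2) * (if y && b then 0 else 1) ≠ 0 →
      c ≤ y := by decide
  have hdiag : ∀ k c : Bool, ∑ b, (planeVec k c b : ZMod 2) * (if c && b then 0 else 1) = 1 := by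
    decide
  have key : ((tensorMatrix κ).map (Int.cast : ℤ → ZMod 2) * sieveMatrix).det ≠ 0 := by
    intro h0
    obtain ⟨v, hv, h⟩ := Matrix.exists_vecMul_eq_zero_iff.2 h0
    apply hv
    funext y
    -- Entry `(x, y)` of the product vanishes unless `x ≤ y`, so once `v` is zero below `y`, column
    -- `y` reads `v y = 0`.
    induction y using WellFoundedLT.induction with
    | ind y ih =>
      have hy := congrFun h y
      rw [Matrix.vecMul, dotProduct, Finset.sum_eq_single y] at hy
      · rw [tensorMatrix_mul_sieveMatrix_apply] at hy
        simpa only [hdiag, Finset.prod_const_one, mul_one] using hy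
      · intro x _ hxy
        by_cases hx : x ≤ y
        · rw [ih x (lt_of_le_of_ne hx hxy)]; simp
        · rw [Pi.le_def] at hx
          push Not at hx
          obtain ⟨i, hi⟩ := hx
          rw [tensorMatrix_mul_sieveMatrix_apply, Finset.prod_eq_zero (Finset.mem_univ i), mul_zero]
          by_contra h'
          exact hi.not_ge (hle _ _ _ h')
      · simp
  intro h
  apply key
  have : ((tensorMatrix κ).map (Int.cast : ℤ → ZMod 2)).det = 0 := by
    have := (Int.castRingHom (ZMod 2)).map_det (tensorMatrix κ)
    rw [h] at this
    simpa using this.symm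
  rw [Matrix.det_mul, this, zero_mul]

/-- A family of points, each with a partition of the coordinates, is at most as large as the
intersection of the union of the cylinders over one class with the antipode of the union of the
cylinders over the other class. -/
theorem card_le_of_cylinder_subset (X R Y : Finset (ι → Bool)) (κ : (ι → Bool) → ι → Bool)
    (hR : ∀ x ∈ X, ∀ z, (∀ i, κ x i = true → z i = x i) → z ∈ R)
    (hY : ∀ x ∈ X, ∀ z, (∀ i, κ x i = false → z i = !x i) → z ∈ Y) :
    X.card ≤ (R ∩ Y).card := by
  let a : (ι → Bool) → (ι → Bool) → ℤ := fun x z => ∏ i, planeCoord (κ x i) (x i) (z i)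
  let b : (ι → Bool) → (ι → Bool) → ℤ := fun x z => ∏ i, planeDual (κ x i) (x i) (z i)
  have hab : ∀ x y, ∑ z, a x z * b y z = ∑ z, tensorMatrix κ x z * tensorMatrix κ y z := by
    intro x y
    simp only [a, b, tensorMatrix, Matrix.of_apply]
    rw [sum_prod_mul_prod (fun i => planeCoord (κ x i) (x i)) (fun i => planeDual (κ y i) (y i)),
      sum_prod_mul_prod (fun i => planeVec (κ x i) (x i)) (fun i => planeVec (κ y i) (y i))]
    exact Finset.prod_congr rfl fun i _ => planeCoord_mul_planeDual _ _ _ _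
  have ha : ∀ x ∈ X, ∀ z, z ∉ R → a x z = 0 := by
    intro x hx z hz
    by_contra h
    refine hz (hR x hx z fun i hi => ?_)
    have := Finset.prod_ne_zero_iff.1 h i (Finset.mem_univ i)
    rw [hi] at this
    exact eq_of_planeCoord_ne_zero this
  have hb : ∀ x ∈ X, ∀ z, z ∉ Y → b x z = 0 := by
    intro x hx z hz
    by_contra h
    refine hz (hY x hx z fun i hi => ?_)
    have := Finset.prod_ne_zero_iff.1 h i (Finset.mem_univ i)
    rw [hi] at this
    exact eq_of_planeDual_ne_zero this
  -- The Gram matrix of the rows indexed by `X` factors through `R ∩ Y`. A relation among the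
  -- restricted `b x` therefore gives a combination of rows orthogonal to all these rows, hence of
  -- norm zero, which the nonzero determinant excludes unless it is trivial.
  have hli : LinearIndependent ℤ (fun (x : X) (z : (R ∩ Y : Finset (ι → Bool))) => b x z) := by
    rw [Fintype.linearIndependent_iff]
    intro c hc
    have h1 : ∀ y : X, ∑ x : X, c x * ∑ z, tensorMatrix κ y z * tensorMatrix κ x z = 0 := by
      intro y
      simp only [← hab, Finset.mul_sum]
      rw [Finset.sum_comm]
      refine Finset.sum_eq_zero fun z _ => ?_
      by_cases hz : z ∈ R ∩ Y
      · have := congrFun hc ⟨z, hz⟩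
        simp only [Finset.sum_apply, Pi.smul_apply, smul_eq_mul, Pi.zero_apply] at this
        calc ∑ x : X, c x * (a y z * b x z) = a y z * ∑ x : X, c x * b x z := by
              rw [Finset.mul_sum]; exact Finset.sum_congr rfl fun _ _ => by ring
          _ = 0 := by rw [this, mul_zero]
      · refine Finset.sum_eq_zero fun x _ => ?_
        rw [Finset.mem_inter, not_and_or] at hz
        rcases hz with hz | hz
        · rw [ha y y.2 z hz]; ring
        · rw [hb x x.2 z hz]; ring
    have h2 : ∑ z, (∑ x : X, c x * tensorMatrix κ x z) ^ 2 = 0 := by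
      calc ∑ z, (∑ x : X, c x * tensorMatrix κ x z) ^ 2
          = ∑ z, ∑ y : X, ∑ x : X, c y * (c x * (tensorMatrix κ y z * tensorMatrix κ x z)) := by
            refine Finset.sum_congr rfl fun z _ => ?_
            rw [sq, Finset.sum_mul_sum]
            exact Finset.sum_congr rfl fun _ _ => Finset.sum_congr rfl fun _ _ => by ring
        _ = ∑ y : X, c y * ∑ x : X, c x * ∑ z, tensorMatrix κ y z * tensorMatrix κ x z := by
            rw [Finset.sum_comm]
            refine Finset.sum_congr rfl fun y _ => ?_
            rw [Finset.sum_comm, Finset.mul_sum]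
            simp only [Finset.mul_sum]
        _ = 0 := Finset.sum_eq_zero fun y _ => by rw [h1 y, mul_zero]
    rw [Finset.sum_eq_zero_iff_of_nonneg fun _ _ => sq_nonneg _] at h2
    let v : (ι → Bool) → ℤ := fun x => if hx : x ∈ X then c ⟨x, hx⟩ else 0
    have hv : Matrix.vecMul v (tensorMatrix κ) = 0 := by
      funext z
      have := h2 z (Finset.mem_univ z)
      rw [sq_eq_zero_iff] at this
      rw [Matrix.vecMul, dotProduct, Pi.zero_apply, ← this,
        ← Finset.sum_subset (Finset.subset_univ X), ← Finset.sum_coe_sort X]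
      · exact Finset.sum_congr rfl fun x _ => by simp [v]
      · intro x _ hx; simp [v, hx]
    intro x
    have := congrFun (Matrix.eq_zero_of_vecMul_eq_zero (det_tensorMatrix_ne_zero κ) hv) x
    simpa [v] using this
  have h := hli.fintype_card_le_finrank
  rwa [Module.finrank_fintype_fun_eq_card, Fintype.card_coe, Fintype.card_coe] at h

/-- Reimer's inequality `|A □ B| ≤ |A ∩ B̄|`, with `B̄` the set of antipodes of points of `B`. -/
theorem ncard_box_le (A B : Set (ι → Bool)) :
    (box A B).ncard ≤ {x | x ∈ A ∧ (fun i => !x i) ∈ B}.ncard := by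
  classical
  have hex : ∀ x : ι → Bool, ∃ k : ι → Bool, x ∈ box A B →
      (∀ z : ι → Bool, (∀ i, k i = true → z i = x i) → z ∈ A) ∧
      (∀ z : ι → Bool, (∀ i, k i = false → z i = x i) → z ∈ B) := by
    intro x
    by_cases hx : x ∈ box A B
    · obtain ⟨K, L, hKL, hA, hB⟩ := hx
      refine ⟨fun i => decide (i ∈ K), fun _ => ⟨fun z hz => hA fun i hi => hz i (by simpa using hi),
        fun z hz => hB fun i hi => hz i ?_⟩⟩
      simpa using fun h => Set.disjoint_left.1 hKL h hi
    · exact ⟨x, fun h => absurd h hx⟩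
  choose κ hκ using hex
  have := card_le_of_cylinder_subset (box A B).toFinset A.toFinset
    {x : ι → Bool | (fun i => !x i) ∈ B}.toFinset κ
    (fun x hx z hz => by
      rw [Set.mem_toFinset] at hx ⊢
      exact (hκ x hx).1 z hz)
    (fun x hx z hz => by
      rw [Set.mem_toFinset] at hx ⊢
      exact (hκ x hx).2 _ fun i hi => by simp [hz i hi])
  rw [← Set.toFinset_inter] at this
  rw [Set.ncard_eq_toFinset_card', Set.ncard_eq_toFinset_card']
  exact this.trans (Finset.card_le_card fun x hx => by simpa using hx)

end Reimer

/-! ### The cube of configurations paired up by an involution -/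

section Fiber

variable {ι : Type*}

/-- `τ` is an involution that exchanges ones and zeros of `ω` off its fixed points. -/
def PairsUp (τ : Equiv.Perm ι) (ω : ι → Bool) : Prop :=
  (∀ i, τ (τ i) = i) ∧ ∀ i, τ i ≠ i → ω (τ i) = !ω i

/-- The configurations paired up by `τ` that agree with `ρ` on the fixed points of `τ`. -/
def fiber (τ : Equiv.Perm ι) (ρ : ι → Bool) : Set (ι → Bool) :=
  {ω | PairsUp τ ω ∧ ∀ i, τ i = i → ω i = ρ i}

open Classical in
/-- The configuration in the fiber of `ω₀` with prescribed values at the ones of `ω₀` that are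
moved by `τ`. -/
noncomputable def fiberPoint (τ : Equiv.Perm ι) (ω₀ : ι → Bool)
    (x : {i // τ i ≠ i ∧ ω₀ i = true} → Bool) : ι → Bool := fun i =>
  if h : τ i ≠ i ∧ ω₀ i = true then x ⟨i, h⟩
  else if h : τ (τ i) ≠ τ i ∧ ω₀ (τ i) = true then !x ⟨τ i, h⟩
  else ω₀ i

variable {τ : Equiv.Perm ι} {ω₀ : ι → Bool}

theorem fiberPoint_of_mem (x : {i // τ i ≠ i ∧ ω₀ i = true} → Bool)
    (i : {i // τ i ≠ i ∧ ω₀ i = true}) : fiberPoint τ ω₀ x i = x i := by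
  simp [fiberPoint, i.2]

theorem fiberPoint_of_map_mem (h : PairsUp τ ω₀) (x : {i // τ i ≠ i ∧ ω₀ i = true} → Bool)
    (i : {i // τ i ≠ i ∧ ω₀ i = true}) : fiberPoint τ ω₀ x (τ i) = !x i := by
  have h1 := h.2 i i.2.1
  rw [i.2.2] at h1
  have h2 := i.2
  simp [fiberPoint, h1, h.1, h2]

theorem fiberPoint_of_fixed (x : {i // τ i ≠ i ∧ ω₀ i = true} → Bool) {i : ι} (hi : τ i = i) :
    fiberPoint τ ω₀ x i = ω₀ i := by
  simp [fiberPoint, hi]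

/-- Every coordinate is fixed by `τ`, or a moved one of `ω₀`, or the image of a moved one. -/
theorem PairsUp.cases (h : PairsUp τ ω₀) (i : ι) :
    τ i = i ∨ (∃ j : {i // τ i ≠ i ∧ ω₀ i = true}, i = j) ∨
      ∃ j : {i // τ i ≠ i ∧ ω₀ i = true}, i = τ j := by
  by_cases hi : τ i = i
  · exact Or.inl hi
  · right
    cases hω : ω₀ i with
    | true => exact Or.inl ⟨⟨i, hi, hω⟩, rfl⟩
    | false =>
      refine Or.inr ⟨⟨τ i, ?_, ?_⟩, (h.1 i).symm⟩
      · rw [h.1]; exact fun h' => hi h'.symm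
      · rw [h.2 i hi, hω]; rfl

theorem fiberPoint_injective : Function.Injective (fiberPoint τ ω₀) := by
  intro x y hxy
  funext i
  rw [← fiberPoint_of_mem x, ← fiberPoint_of_mem y, hxy]

theorem pairsUp_fiberPoint (h : PairsUp τ ω₀) (x : {i // τ i ≠ i ∧ ω₀ i = true} → Bool) :
    PairsUp τ (fiberPoint τ ω₀ x) := by
  refine ⟨h.1, fun i hi => ?_⟩
  rcases h.cases i with h' | ⟨j, rfl⟩ | ⟨j, rfl⟩
  · exact absurd h' hi
  · rw [fiberPoint_of_mem, fiberPoint_of_map_mem h]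
  · rw [fiberPoint_of_map_mem h, h.1, fiberPoint_of_mem, Bool.not_not]

theorem fiberPoint_comp (h : PairsUp τ ω₀) (x : {i // τ i ≠ i ∧ ω₀ i = true} → Bool) :
    fiberPoint τ ω₀ x ∘ τ = fiberPoint τ ω₀ fun i => !x i := by
  funext i
  rw [Function.comp_apply]
  rcases h.cases i with h' | ⟨j, rfl⟩ | ⟨j, rfl⟩
  · rw [h', fiberPoint_of_fixed _ h', fiberPoint_of_fixed _ h']
  · rw [fiberPoint_of_mem, fiberPoint_of_map_mem h]
  · rw [fiberPoint_of_map_mem h, h.1, fiberPoint_of_mem, Bool.not_not]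

theorem exists_fiberPoint_eq (h : PairsUp τ ω₀) {ω : ι → Bool} (hω : PairsUp τ ω)
    (hfix : ∀ i, τ i = i → ω i = ω₀ i) : ∃ x, fiberPoint τ ω₀ x = ω := by
  refine ⟨fun i => ω i, funext fun i => ?_⟩
  rcases h.cases i with h' | ⟨j, rfl⟩ | ⟨j, rfl⟩
  · rw [fiberPoint_of_fixed _ h', hfix i h']
  · rw [fiberPoint_of_mem]
  · rw [fiberPoint_of_map_mem h, hω.2 j j.2.1]

/-- A set of ones of `fiberPoint τ ω₀ x` whose cylinder lies in `A` determines a set of coordinates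
of `x` whose cylinder lies in the preimage of `A`. -/
theorem cylinder_subset_preimage_fiberPoint (h : PairsUp τ ω₀) {A : Set (ι → Bool)}
    (hA : IsUpperSet A) {x : {i // τ i ≠ i ∧ ω₀ i = true} → Bool} {K : Set ι}
    (hK : cylinder (fiberPoint τ ω₀ x) K ⊆ A) :
    cylinder x {i | (x i = true ∧ (i : ι) ∈ K) ∨ (x i = false ∧ τ i ∈ K)} ⊆
      fiberPoint τ ω₀ ⁻¹' A := by
  classical
  intro y hy
  -- The least element of the cylinder already lies in `A`, so only the ones in `K` need to be
  -- retained.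
  have hmem : (fun i => if i ∈ K then fiberPoint τ ω₀ x i else false) ∈ A :=
    hK fun i hi => by simp [hi]
  refine hA (fun i => ?_) hmem
  by_cases hi : i ∈ K
  · simp only [hi, if_true]
    rcases h.cases i with h' | ⟨j, rfl⟩ | ⟨j, rfl⟩
    · rw [fiberPoint_of_fixed _ h', fiberPoint_of_fixed _ h']
    · rw [fiberPoint_of_mem, fiberPoint_of_mem]
      cases hx : x j with
      | true => rw [hy j (Or.inl ⟨hx, hi⟩), hx]
      | false => exact Bool.false_le _
    · rw [fiberPoint_of_map_mem h, fiberPoint_of_map_mem h]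
      cases hx : x j with
      | true => exact Bool.false_le _
      | false => rw [hy j (Or.inr ⟨hx, hi⟩), hx]
  · simp [hi]

theorem ncard_fiber_inter_box_le [Finite ι] (τ : Equiv.Perm ι) (ρ : ι → Bool)
    {A B : Set (ι → Bool)} (hA : IsUpperSet A) (hB : IsUpperSet B) :
    (fiber τ ρ ∩ box A B).ncard ≤ (fiber τ ρ ∩ {ω | ω ∈ A ∧ ω ∘ τ ∈ B}).ncard := by
  classical
  have := Fintype.ofFinite ι
  rcases (fiber τ ρ).eq_empty_or_nonempty with h0 | ⟨ω₀, h, hρ⟩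
  · simp [h0]
  have h1 : fiber τ ρ ∩ box A B ⊆
      fiberPoint τ ω₀ '' box (fiberPoint τ ω₀ ⁻¹' A) (fiberPoint τ ω₀ ⁻¹' B) := by
    rintro ω ⟨⟨hω, hωρ⟩, K, L, hKL, hK, hL⟩
    obtain ⟨x, rfl⟩ := exists_fiberPoint_eq h hω fun i hi => (hωρ i hi).trans (hρ i hi).symm
    refine ⟨x, ⟨_, _, ?_, cylinder_subset_preimage_fiberPoint h hA hK,
      cylinder_subset_preimage_fiberPoint h hB hL⟩, rfl⟩
    -- The bit `x i` decides which of `i`, `τ i` carries the one, so a bit used for both events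
    -- would put that coordinate in both `K` and `L`.
    rw [Set.disjoint_left] at hKL ⊢
    rintro i (⟨hx, hi⟩ | ⟨hx, hi⟩) (⟨hx', hi'⟩ | ⟨hx', hi'⟩)
    · exact hKL hi hi'
    · simp [hx] at hx'
    · simp [hx] at hx'
    · exact hKL hi hi'
  have h2 : fiberPoint τ ω₀ '' {x | x ∈ fiberPoint τ ω₀ ⁻¹' A ∧
      (fun i => !x i) ∈ fiberPoint τ ω₀ ⁻¹' B} ⊆ fiber τ ρ ∩ {ω | ω ∈ A ∧ ω ∘ τ ∈ B} := by
    rintro _ ⟨x, ⟨hxA, hxB⟩, rfl⟩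
    refine ⟨⟨pairsUp_fiberPoint h x, fun i hi => ?_⟩, hxA, ?_⟩
    · rw [fiberPoint_of_fixed _ hi, hρ i hi]
    · rw [fiberPoint_comp h]; exact hxB
  calc (fiber τ ρ ∩ box A B).ncard
      ≤ (fiberPoint τ ω₀ '' box (fiberPoint τ ω₀ ⁻¹' A) (fiberPoint τ ω₀ ⁻¹' B)).ncard :=
        Set.ncard_le_ncard h1 (Set.toFinite _)
    _ ≤ (box (fiberPoint τ ω₀ ⁻¹' A) (fiberPoint τ ω₀ ⁻¹' B)).ncard :=
        Set.ncard_image_le (Set.toFinite _)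
    _ ≤ _ := ncard_box_le _ _
    _ = _ := (Set.ncard_image_of_injective _ fiberPoint_injective).symm
    _ ≤ _ := Set.ncard_le_ncard h2 (Set.toFinite _)

end Fiber

/-! ### Sharing the mass of a pair among its mates -/

section Weights

variable {ι : Type*} {J : Type*}

/-- The colour-preserving involutions that map `ω` to `ω'` and move only coordinates at which `ω`
and `ω'` differ. -/
def mates (c : ι → J) (ω ω' : ι → Bool) : Set (Equiv.Perm ι) :=
  {τ | (∀ i, c (τ i) = c i) ∧ PairsUp τ ω ∧ ω' = ω ∘ τ}

/-- Conjugation by `g` carries mates to mates injectively. -/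
theorem ncard_mates_le_comp [Finite ι] (c : ι → J) (ω ω' : ι → Bool) {g : Equiv.Perm ι}
    (hg : ∀ i, c (g i) = c i) : (mates c ω ω').ncard ≤ (mates c (ω ∘ g) (ω' ∘ g)).ncard := by
  refine Set.ncard_le_ncard_of_injOn (fun τ => (g.trans τ).trans g.symm) ?_ ?_ (Set.toFinite _)
  · rintro τ ⟨hc, ⟨hi, hp⟩, rfl⟩
    have hg' : ∀ i, c (g.symm i) = c i := fun i => by rw [← hg, g.apply_symm_apply]
    refine ⟨fun i => ?_, ⟨fun i => ?_, fun i h => ?_⟩, ?_⟩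
    · simp [hg', hc, hg]
    · simp [hi]
    · simp only [Equiv.trans_apply, Function.comp_apply, Equiv.apply_symm_apply]
      exact hp _ fun h' => h (by simp [h'])
    · funext i; simp
  · intro τ _ τ' _ h
    ext i
    simpa using Equiv.congr_fun h (g.symm i)

theorem ncard_mates_comp [Finite ι] (c : ι → J) (ω ω' : ι → Bool) {g : Equiv.Perm ι}
    (hg : ∀ i, c (g i) = c i) : (mates c (ω ∘ g) (ω' ∘ g)).ncard = (mates c ω ω').ncard := by
  refine le_antisymm ?_ (ncard_mates_le_comp c ω ω' hg)
  have hg' : ∀ i, c (g.symm i) = c i := fun i => by rw [← hg, g.apply_symm_apply]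
  have h := ncard_mates_le_comp c (ω ∘ g) (ω' ∘ g) hg'
  have e : ∀ α : ι → Bool, (α ∘ g) ∘ g.symm = α := fun α => by funext i; simp
  rwa [e, e] at h

/-- Two configurations in one fiber of `τ` differ by a colour-preserving permutation that commutes
with `τ` on them. -/
theorem exists_perm_of_pairsUp {c : ι → J} {τ : Equiv.Perm ι} (hc : ∀ i, c (τ i) = c i)
    {ω ω₁ : ι → Bool} (hω : PairsUp τ ω) (hω₁ : PairsUp τ ω₁)
    (hfix : ∀ i, τ i = i → ω₁ i = ω i) :
    ∃ g : Equiv.Perm ι, (∀ i, c (g i) = c i) ∧ ω₁ = ω ∘ g ∧ ω₁ ∘ τ = (ω ∘ τ) ∘ g := by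
  -- The permutation swaps the 2-cycles of `τ` on which `ω` and `ω₁` disagree; both ends of a
  -- 2-cycle disagree together.
  have hinv : Function.Involutive fun i => if ω₁ i = ω i then i else τ i := by
    intro i
    by_cases h : ω₁ i = ω i
    · simp [h]
    · have hi : τ i ≠ i := fun h' => h (hfix i h')
      simp [h, hω.1, hω.2 i hi, hω₁.2 i hi]
  refine ⟨hinv.toPerm, fun i => ?_, funext fun i => ?_, funext fun i => ?_⟩ <;>
    simp only [Function.Involutive.coe_toPerm, Function.comp_apply]
  · split_ifs
    · rfl
    · exact hc i
  · split_ifs with h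
    · exact h
    · rw [hω.2 i fun h' => h (hfix i h')]
      exact Bool.eq_not.2 h
  · split_ifs with h
    · by_cases hi : τ i = i
      · rw [hi, h]
      · rw [hω.2 i hi, hω₁.2 i hi, h]
    · rw [hω.1, hω₁.2 i fun h' => h (hfix i h'), Bool.eq_not.2 h, Bool.not_not]

variable [Fintype ι]

open Classical in
theorem sum_fiber_box_le (τ : Equiv.Perm ι) (V : (ι → Bool) → ℝ≥0)
    (hV : ∀ ω ω₁, PairsUp τ ω → PairsUp τ ω₁ → (∀ i, τ i = i → ω₁ i = ω i) → V ω₁ = V ω)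
    {A B : Set (ι → Bool)} (hA : IsUpperSet A) (hB : IsUpperSet B) :
    ∑ ω with PairsUp τ ω ∧ ω ∈ box A B, V ω ≤
      ∑ ω with PairsUp τ ω ∧ (ω ∈ A ∧ ω ∘ τ ∈ B), V ω := by
  -- `r` records the values at fixed points and is constantly `false` elsewhere; its classes among
  -- paired-up configurations are the fibers, on which `V` is constant.
  let r : (ι → Bool) → ι → Bool := fun ω i => if τ i = i then ω i else false
  have hr : ∀ ω ω₁, r ω₁ = r ω ↔ ∀ i, τ i = i → ω₁ i = ω i := by
    intro ω ω₁
    refine ⟨fun h i hi => by simpa [r, hi] using congrFun h i, fun h => funext fun i => ?_⟩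
    by_cases hi : τ i = i
    · simp [r, hi, h i hi]
    · simp [r, hi]
  rw [← Finset.sum_fiberwise (Finset.univ.filter fun ω => PairsUp τ ω ∧ ω ∈ box A B) r,
    ← Finset.sum_fiberwise (Finset.univ.filter fun ω => PairsUp τ ω ∧ (ω ∈ A ∧ ω ∘ τ ∈ B)) r]
  refine Finset.sum_le_sum fun ρ _ => ?_
  by_cases h : ∃ ω₀, PairsUp τ ω₀ ∧ r ω₀ = ρ
  · obtain ⟨ω₀, hω₀, rfl⟩ := h
    have key : ∀ (Q : (ι → Bool) → Prop) [DecidablePred Q],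
        ∑ ω ∈ Finset.univ.filter (fun ω => PairsUp τ ω ∧ Q ω) with r ω = r ω₀, V ω =
          (fiber τ ω₀ ∩ {ω | Q ω}).ncard * V ω₀ := by
      intro Q _
      have hset : fiber τ ω₀ ∩ {ω | Q ω} = ((Finset.univ.filter fun ω => PairsUp τ ω ∧ Q ω).filter
          fun ω => r ω = r ω₀ : Finset (ι → Bool)) := by
        ext ω
        simp only [Finset.coe_filter, Finset.mem_filter, Finset.mem_univ, true_and, hr]
        exact and_right_comm
      rw [hset, Set.ncard_coe_finset, Finset.sum_congr rfl (g := fun _ => V ω₀),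
        Finset.sum_const, nsmul_eq_mul]
      intro ω hω
      simp only [Finset.mem_filter, Finset.mem_univ, true_and] at hω
      exact hV _ _ hω₀ hω.1.1 ((hr _ _).1 hω.2)
    rw [key (fun ω => ω ∈ box A B), key (fun ω => ω ∈ A ∧ ω ∘ τ ∈ B)]
    have hle : ((fiber τ ω₀ ∩ {ω | ω ∈ box A B}).ncard : ℝ≥0) ≤
        (fiber τ ω₀ ∩ {ω | ω ∈ A ∧ ω ∘ τ ∈ B}).ncard :=
      Nat.cast_le.2 (ncard_fiber_inter_box_le τ ω₀ hA hB)
    gcongr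
  · refine (Finset.sum_eq_zero fun ω hω => ?_).trans_le zero_le
    simp only [Finset.mem_filter, Finset.mem_univ, true_and] at hω
    exact absurd ⟨ω, hω.1.1, hω.2⟩ h

open Classical in
theorem sum_sum_eq_sum_mates (c : ι → J) (W : (ι → Bool) → ℝ≥0)
    (hW : ∀ ω ω', W ω ≠ 0 → W ω' ≠ 0 → (mates c ω ω').Nonempty)
    (Q : (ι → Bool) → (ι → Bool) → Prop) [∀ ω ω', Decidable (Q ω ω')] :
    ∑ ω, ∑ ω', (if Q ω ω' then W ω * W ω' else 0) =
      ∑ τ : Equiv.Perm ι with ∀ i, c (τ i) = c i, ∑ ω with PairsUp τ ω ∧ Q ω (ω ∘ τ),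
        W ω * W (ω ∘ τ) / (mates c ω (ω ∘ τ)).ncard := by
  have h1 : ∀ ω ω', (if Q ω ω' then W ω * W ω' else 0) =
      ∑ τ : Equiv.Perm ι, if τ ∈ mates c ω ω' ∧ Q ω ω' then
        W ω * W ω' / (mates c ω ω').ncard else 0 := by
    intro ω ω'
    by_cases hQ : Q ω ω'
    · simp only [hQ, and_true, if_true]
      rw [← Finset.sum_filter, Finset.sum_const, nsmul_eq_mul, Set.ncard_eq_toFinset_card',
        show Finset.univ.filter (fun τ => τ ∈ mates c ω ω') = (mates c ω ω').toFinset by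
          ext; simp]
      -- Only a pair of zero mass can lack mates, so division by zero loses nothing.
      by_cases h0 : W ω * W ω' = 0
      · simp [h0]
      · rw [mul_div_cancel₀]
        obtain ⟨τ, hτ⟩ := hW ω ω' (left_ne_zero_of_mul h0) (right_ne_zero_of_mul h0)
        rw [Nat.cast_ne_zero]
        exact Finset.card_ne_zero_of_mem (Set.mem_toFinset.2 hτ)
    · simp [hQ]
  simp only [h1]
  rw [Finset.sum_congr rfl fun ω _ => Finset.sum_comm, Finset.sum_comm, Finset.sum_filter]
  refine Finset.sum_congr rfl fun τ _ => ?_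
  by_cases hc : ∀ i, c (τ i) = c i
  · rw [if_pos hc, Finset.sum_filter]
    refine Finset.sum_congr rfl fun ω _ => ?_
    rw [Finset.sum_eq_single (ω ∘ τ)]
    · simp [mates, hc]
    · intro ω' _ h
      simp [mates, h]
    · simp
  · simp [mates, hc]

open Classical in
/-- The BK inequality for weights that are invariant on pairs under exchanges along mates. -/
theorem sum_box_mul_sum_le (c : ι → J) (W : (ι → Bool) → ℝ≥0)
    (hW : ∀ ω ω', W ω ≠ 0 → W ω' ≠ 0 → (mates c ω ω').Nonempty)
    (hinv : ∀ τ : Equiv.Perm ι, (∀ i, c (τ i) = c i) → ∀ ω ω₁, PairsUp τ ω → PairsUp τ ω₁ →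
      (∀ i, τ i = i → ω₁ i = ω i) → W ω₁ * W (ω₁ ∘ τ) = W ω * W (ω ∘ τ))
    {A B : Set (ι → Bool)} (hA : IsUpperSet A) (hB : IsUpperSet B) :
    (∑ ω with ω ∈ box A B, W ω) * ∑ ω, W ω ≤
      (∑ ω with ω ∈ A, W ω) * ∑ ω with ω ∈ B, W ω := by
  have hl : (∑ ω with ω ∈ box A B, W ω) * ∑ ω, W ω =
      ∑ ω, ∑ ω', if ω ∈ box A B then W ω * W ω' else 0 := by
    rw [Finset.sum_mul_sum, Finset.sum_filter]
    refine Finset.sum_congr rfl fun ω _ => ?_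
    by_cases h : ω ∈ box A B <;> simp [h]
  have hr : (∑ ω with ω ∈ A, W ω) * ∑ ω with ω ∈ B, W ω =
      ∑ ω, ∑ ω', if ω ∈ A ∧ ω' ∈ B then W ω * W ω' else 0 := by
    rw [Finset.sum_mul_sum, Finset.sum_filter]
    refine Finset.sum_congr rfl fun ω _ => ?_
    by_cases h : ω ∈ A <;> simp [h, Finset.sum_filter]
  rw [hl, hr, sum_sum_eq_sum_mates c W hW (fun ω _ => ω ∈ box A B),
    sum_sum_eq_sum_mates c W hW (fun ω ω' => ω ∈ A ∧ ω' ∈ B)]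
  refine Finset.sum_le_sum fun τ hτ => sum_fiber_box_le τ
    (fun ω => W ω * W (ω ∘ τ) / (mates c ω (ω ∘ τ)).ncard) ?_ hA hB
  simp only [Finset.mem_filter, Finset.mem_univ, true_and] at hτ
  intro ω ω₁ hω hω₁ hfix
  obtain ⟨g, hg, h1, h2⟩ := exists_perm_of_pairsUp hτ hω hω₁ hfix
  simp only [hinv τ hτ ω ω₁ hω hω₁ hfix]
  rw [h2, h1, ncard_mates_comp c _ _ hg]

variable [DecidableEq J]

/-- The number of ones of colour `j`. -/
def colorCount (c : ι → J) (ω : ι → Bool) (j : J) : ℕ :=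
  ∑ i with c i = j, (ω i).toNat

theorem colorCount_comp (c : ι → J) (ω : ι → Bool) {g : Equiv.Perm ι}
    (hg : ∀ i, c (g i) = c i) : colorCount c (ω ∘ g) = colorCount c ω := by
  funext j
  exact Finset.sum_equiv g (by simp [hg]) (by simp)

/-- Configurations with the same number of ones of each colour are connected by a mate. -/
theorem mates_nonempty (c : ι → J) {ω ω' : ι → Bool} (h : colorCount c ω = colorCount c ω') :
    (mates c ω ω').Nonempty := by
  classical
  let S := {i // ω i = true ∧ ω' i = false}
  let S' := {i // ω i = false ∧ ω' i = true}
  -- Common ones contribute equally to both colour counts and cancel. A colourwise bijection `S ≃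
  -- S'` then supplies the 2-cycles.
  have hcard : ∀ j, Fintype.card {a : S // c a = j} = Fintype.card {a : S' // c a = j} := by
    intro j
    have e1 : Fintype.card {a : S // c a = j} =
        ∑ i with c i = j, (ω i && !ω' i).toNat := by
      rw [Fintype.card_congr (Equiv.subtypeSubtypeEquivSubtypeInter _ fun i => c i = j),
        Fintype.card_subtype, Finset.card_filter, Finset.sum_filter]
      refine Finset.sum_congr rfl fun i _ => ?_
      by_cases hc : c i = j <;> cases ω i <;> cases ω' i <;> simp [hc]
    have e2 : Fintype.card {a : S' // c a = j} =
        ∑ i with c i = j, (!ω i && ω' i).toNat := by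
      rw [Fintype.card_congr (Equiv.subtypeSubtypeEquivSubtypeInter _ fun i => c i = j),
        Fintype.card_subtype, Finset.card_filter, Finset.sum_filter]
      refine Finset.sum_congr rfl fun i _ => ?_
      by_cases hc : c i = j <;> cases ω i <;> cases ω' i <;> simp [hc]
    have e3 : colorCount c ω j = ∑ i with c i = j, (ω i && !ω' i).toNat +
        ∑ i with c i = j, (ω i && ω' i).toNat := by
      rw [← Finset.sum_add_distrib]
      refine Finset.sum_congr rfl fun i _ => ?_
      cases ω i <;> cases ω' i <;> rfl
    have e4 : colorCount c ω' j = ∑ i with c i = j, (!ω i && ω' i).toNat +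
        ∑ i with c i = j, (ω i && ω' i).toNat := by
      rw [← Finset.sum_add_distrib]
      refine Finset.sum_congr rfl fun i _ => ?_
      cases ω i <;> cases ω' i <;> rfl
    have := congrFun h j
    omega
  let e : S ≃ S' := Equiv.ofFiberEquiv (f := fun a : S => c a) (g := fun a : S' => c a)
    fun j => Fintype.equivOfCardEq (hcard j)
  have he : ∀ a : S, c (e a) = c a := fun a =>
    Equiv.ofFiberEquiv_map (f := fun a : S => c a) (g := fun a : S' => c a) _ a
  have he' : ∀ a : S', c (e.symm a) = c a := fun a => by rw [← he, e.apply_symm_apply]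
  let t : ι → ι := fun i => if hi : ω i = true ∧ ω' i = false then (e ⟨i, hi⟩ : ι)
    else if hi : ω i = false ∧ ω' i = true then (e.symm ⟨i, hi⟩ : ι) else i
  have t1 : ∀ a : S, t a = e a := fun a => by simp [t, a.2]
  have t2 : ∀ a : S', t a = e.symm a := fun a => by simp [t, a.2]
  have t3 : ∀ i, ω i = ω' i → t i = i := fun i hi => by
    cases h' : ω' i <;> simp [t, hi, h']
  have hcases : ∀ i : ι, (∃ a : S, i = (a : ι)) ∨ (∃ a : S', i = (a : ι)) ∨ ω i = ω' i := by
    intro i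
    cases h1 : ω i <;> cases h2 : ω' i
    · simp
    · exact Or.inr (Or.inl ⟨⟨i, h1, h2⟩, rfl⟩)
    · exact Or.inl ⟨⟨i, h1, h2⟩, rfl⟩
    · simp
  have ht : Function.Involutive t := by
    intro i
    rcases hcases i with ⟨a, rfl⟩ | ⟨a, rfl⟩ | hi
    · rw [t1, t2, e.symm_apply_apply]
    · rw [t2, t1, e.apply_symm_apply]
    · rw [t3 i hi, t3 i hi]
  refine ⟨ht.toPerm, fun i => ?_, ⟨ht, fun i hi => ?_⟩, funext fun i => ?_⟩ <;>
    simp only [Function.Involutive.coe_toPerm, Function.comp_apply] at *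
  · rcases hcases i with ⟨a, rfl⟩ | ⟨a, rfl⟩ | hi
    · rw [t1, he]
    · rw [t2, he']
    · rw [t3 i hi]
  · rcases hcases i with ⟨a, rfl⟩ | ⟨a, rfl⟩ | hi'
    · rw [t1, a.2.1, (e a).2.1]; rfl
    · rw [t2, a.2.1, (e.symm a).2.1]; rfl
    · exact absurd (t3 i hi') hi
  · rcases hcases i with ⟨a, rfl⟩ | ⟨a, rfl⟩ | hi
    · rw [t1, a.2.2, (e a).2.1]
    · rw [t2, a.2.2, (e.symm a).2.1]
    · rw [t3 i hi, hi]

variable [Fintype J]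

/-- The product weight restricted to configurations with `k j` ones of colour `j`. -/
def colorWeight (c : ι → J) (k : J → ℕ) (w : ι → ℝ≥0) (ω : ι → Bool) : ℝ≥0 :=
  if colorCount c ω = k then ∏ i, w i ^ (ω i).toNat else 0

/-- In the product, `w i` has exponent 1 if `τ` moves `i` and twice the common value at `i`
otherwise. -/
theorem colorWeight_mul_comp (c : ι → J) (k : J → ℕ) (w : ι → ℝ≥0) {τ : Equiv.Perm ι}
    (hτ : ∀ i, c (τ i) = c i) {ω ω₁ : ι → Bool} (hω : PairsUp τ ω) (hω₁ : PairsUp τ ω₁)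
    (hfix : ∀ i, τ i = i → ω₁ i = ω i) :
    colorWeight c k w ω₁ * colorWeight c k w (ω₁ ∘ τ) =
      colorWeight c k w ω * colorWeight c k w (ω ∘ τ) := by
  obtain ⟨g, hg, h1, -⟩ := exists_perm_of_pairsUp hτ hω hω₁ hfix
  have hcount : colorCount c ω₁ = colorCount c ω := by rw [h1, colorCount_comp c ω hg]
  simp only [colorWeight, colorCount_comp c _ hτ, hcount]
  split_ifs
  · rw [← Finset.prod_mul_distrib, ← Finset.prod_mul_distrib]
    refine Finset.prod_congr rfl fun i _ => ?_
    rw [← pow_add, ← pow_add, Function.comp_apply, Function.comp_apply]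
    congr 1
    by_cases hi : τ i = i
    · rw [hi, hfix i hi]
    · rw [hω.2 i hi, hω₁.2 i hi]
      cases ω i <;> cases ω₁ i <;> rfl
  · rfl

open Classical in
theorem sum_box_colorWeight_mul_le (c : ι → J) (k : J → ℕ) (w : ι → ℝ≥0)
    {A B : Set (ι → Bool)} (hA : IsUpperSet A) (hB : IsUpperSet B) :
    (∑ ω with ω ∈ box A B, colorWeight c k w ω) * ∑ ω, colorWeight c k w ω ≤
      (∑ ω with ω ∈ A, colorWeight c k w ω) * ∑ ω with ω ∈ B, colorWeight c k w ω := by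
  refine sum_box_mul_sum_le c _ (fun ω ω' h h' => mates_nonempty c ?_)
    (fun τ hτ ω ω₁ hω hω₁ hfix => colorWeight_mul_comp c k w hτ hω hω₁ hfix) hA hB
  rw [colorWeight, Ne, ite_eq_right_iff, not_forall] at h h'
  exact h.1.trans h'.1.symm

/-- A probability measure whose point masses are proportional to a colour weight has the BK
property. -/
theorem isBK_of_colorWeight (μ : Measure (ι → Bool)) [IsProbabilityMeasure μ] (c : ι → J)
    (k : J → ℕ) (w : ι → ℝ≥0) (C : ℝ≥0) (hμ : ∀ ω, μ {ω} = (C * colorWeight c k w ω : ℝ≥0)) :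
    IsBK μ := by
  classical
  have hsum : ∀ S : Set (ι → Bool),
      μ S = ((C * ∑ ω with ω ∈ S, colorWeight c k w ω : ℝ≥0) : ℝ≥0∞) := by
    intro S
    have hS : ((Finset.univ.filter (· ∈ S) : Finset (ι → Bool)) : Set (ι → Bool)) = S := by
      ext; simp
    conv_lhs => rw [← hS]
    rw [← sum_measure_singleton, Finset.mul_sum, ENNReal.ofNNReal_finsetSum]
    exact Finset.sum_congr rfl fun ω _ => hμ ω
  have htot : C * ∑ ω, colorWeight c k w ω = 1 := by
    have h := hsum Set.univ
    rw [measure_univ] at h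
    simpa using (ENNReal.coe_injective h).symm
  intro A B hA hB
  rw [hsum, hsum, hsum, ← ENNReal.coe_mul, ENNReal.coe_le_coe]
  calc C * ∑ ω with ω ∈ box A B, colorWeight c k w ω
      = (C * C) * ((∑ ω with ω ∈ box A B, colorWeight c k w ω) *
          ∑ ω, colorWeight c k w ω) := by
        rw [mul_mul_mul_comm, htot, mul_one]
    _ ≤ (C * C) * ((∑ ω with ω ∈ A, colorWeight c k w ω) *
          ∑ ω with ω ∈ B, colorWeight c k w ω) := by
        exact mul_le_mul_of_nonneg_left (sum_box_colorWeight_mul_le c k w hA hB) zero_le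
    _ = _ := by rw [mul_mul_mul_comm]

end Weights

/-! ### Point masses of the weighted and product measures -/

section Measures

variable {ι : Type*} [Fintype ι] [DecidableEq ι]

theorem weightedMeasure_singleton (k : ℕ) (w : ι → ℝ≥0) (ω : ι → Bool) :
    weightedMeasure k w {ω} = (rawWeight k w ω / totalWeight k w : ℝ≥0) := by
  rw [weightedMeasure, Measure.finsetSum_apply, Finset.sum_eq_single ω]
  · simp
  · intro ω' _ h
    simp [h]
  · simp

theorem isProbabilityMeasure_weightedMeasure {k : ℕ} {w : ι → ℝ≥0} (h : totalWeight k w ≠ 0) :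
    IsProbabilityMeasure (weightedMeasure k w) := by
  constructor
  rw [← Finset.coe_univ, ← sum_measure_singleton]
  simp only [weightedMeasure_singleton]
  rw [← ENNReal.ofNNReal_finsetSum, ← Finset.sum_div, ← totalWeight, div_self h, ENNReal.coe_one]

theorem isBK_weightedMeasure {k : ℕ} {w : ι → ℝ≥0} (h : totalWeight k w ≠ 0) :
    IsBK (weightedMeasure k w) := by
  have := isProbabilityMeasure_weightedMeasure h
  refine isBK_of_colorWeight _ (fun _ => ()) (fun _ => k) w (totalWeight k w)⁻¹ fun ω => ?_
  rw [weightedMeasure_singleton, div_eq_inv_mul]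
  congr 2
  simp only [rawWeight, colorWeight, funext_iff, colorCount, numOnes, Finset.filter_true,
    forall_const]
  congr

theorem measurable_uncurry_sigma {J : Type*} {κ : J → Type*} :
    Measurable (fun (x : (j : J) → κ j → Bool) (p : Σ j, κ j) => x p.1 p.2) :=
  measurable_pi_lambda _ fun p => (measurable_pi_apply p.2).comp (measurable_pi_apply p.1)

theorem isBK_productMeasure {J : Type*} [Fintype J] [DecidableEq J] {κ : J → Type*}
    [∀ j, Fintype (κ j)] [∀ j, DecidableEq (κ j)] {k : J → ℕ} {w : (j : J) → κ j → ℝ≥0}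
    (h : ∀ j, totalWeight (k j) (w j) ≠ 0) :
    IsBK (productMeasure fun j => weightedMeasure (k j) (w j)) := by
  have := fun j => isProbabilityMeasure_weightedMeasure (h j)
  have hp : IsProbabilityMeasure (productMeasure fun j => weightedMeasure (k j) (w j)) :=
    Measure.isProbabilityMeasure_map measurable_uncurry_sigma.aemeasurable
  -- The colour of a coordinate is its factor, so the ones are counted separately in each factor.
  refine isBK_of_colorWeight _ Sigma.fst k (fun p => w p.1 p.2)
    (∏ j, (totalWeight (k j) (w j))⁻¹) fun ω => ?_
  have hpre : (fun (x : (j : J) → κ j → Bool) (p : Σ j, κ j) => x p.1 p.2) ⁻¹' {ω} =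
      {fun j i => ω ⟨j, i⟩} := by
    ext x
    simp only [Set.mem_preimage, Set.mem_singleton_iff]
    exact ⟨fun hx => by rw [← hx], fun hx => by rw [hx]⟩
  have hcount : ∀ j, colorCount (Sigma.fst : (Σ j, κ j) → J) ω j =
      numOnes fun i => ω ⟨j, i⟩ := by
    intro j
    rw [colorCount, Finset.sum_filter, Fintype.sum_sigma, Finset.sum_eq_single j]
    · simp [numOnes]
    · intro j' _ hj; simp [hj]
    · simp
  rw [productMeasure, Measure.map_apply measurable_uncurry_sigma (measurableSet_singleton _), hpre,
    ← Set.univ_pi_singleton, Measure.pi_pi]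
  simp only [weightedMeasure_singleton]
  rw [← ENNReal.ofNNReal_finsetProd]
  congr 1
  simp only [div_eq_inv_mul, Finset.prod_mul_distrib]
  congr 1
  simp only [rawWeight, colorWeight, funext_iff, hcount]
  split_ifs with hk
  · rw [Fintype.prod_sigma]
    exact Finset.prod_congr rfl fun j _ => by rw [if_pos (hk j)]
  · obtain ⟨j, hj⟩ := not_forall.1 hk
    exact Finset.prod_eq_zero (Finset.mem_univ j) (if_neg hj)

end Measures

end BKProperty

theorem mainTheorem4 :
    (∀ (n k : ℕ) (w : Fin n → ℝ≥0), BKProperty.totalWeight k w ≠ 0 →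
      BKProperty.IsBK (BKProperty.weightedMeasure k w)) ∧
    (∀ (l : ℕ) (n k : Fin l → ℕ) (w : (j : Fin l) → Fin (n j) → ℝ≥0),
      (∀ j, BKProperty.totalWeight (k j) (w j) ≠ 0) →
      BKProperty.IsBK
        (BKProperty.productMeasure fun j => BKProperty.weightedMeasure (k j) (w j))) :=
  ⟨fun _ _ _ h => BKProperty.isBK_weightedMeasure h,
    fun _ _ _ _ h => BKProperty.isBK_productMeasure h⟩
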